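/- Let $L$ be a real $d\times d$ matrix with $\det L\neq 0$, let $\mathcal L=L\mathbb Z^d$ and $\mathcal C=L[-\tfrac12,\tfrac12]^d$, and let $W_{\mathcal L}\in L^\infty(\mathbb R^d)$ be real and $\mathcal L$-periodic. Assume that all eigenvalues of $-\tfrac12\Delta+W_{\mathcal L}$ on $L^2(\mathcal C)$ with periodic boundary conditions are simple; let $E_0<E_1<\dots$ be these eigenvalues and $(v_n)_{n\in\mathbb N}$ an orthonormal basis of $L^2(\mathcal C)$ of corresponding ($\mathcal L$-periodic) eigenfunctions. Put $\omega_{nn'}=E_n-E_{n'}$, $$P_{nn'}=\int_{\mathcal C}\overline{v_n}\,\nabla v_{n'}\,dz,\qquad \mathbb M_n^{-1}=I-2\sum_{n'\neq n}\frac{P_{nn'}\otimes P_{n'n}}{E_n-E_{n'}} .$$ Let $\mu>0$ and let $V\in\mathcal W_\mu$, that is, $V=V(x,z)\in L^\infty(\mathbb R^{d}\times\mathbb R^d)$ is real, $\mathcal L$-periodic in $z$, and $$\operatorname*{ess\,sup}_{z\in\mathcal C}\int_{\mathbb R^d}(1+|k|)^\mu\,|\widehat V(k,z)|\,dk<\infty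 ,$$ where $\widehat V(\cdot,z)$ is the (distributional) Fourier transform of $V(\cdot,z)$; put $V_{nn'}(x)=\int_{\mathcal C}\overline{v_n(z)}\,v_{n'}(z)\,V(x,z)\,dz$. Let $\mathcal L^2=\ell^2(\mathbb N,L^2(\mathbb R^d))$ and $\mathcal H^\mu=\ell^2(\mathbb N,H^\mu(\mathbb R^d))$, and let $f^{in,\epsilon}\in\mathcal L^2$ $(\epsilon>0)$ and $f^{in}\in\mathcal L^2$ be such that $f^{in,\epsilon}$ is bounded in $\mathcal H^\mu$ uniformly as $\epsilon\to0^+$ and $\lim_{\epsilon\to0^+}\|f^{in,\epsilon}-f^{in}\|_{\mathcal L^2}=0$. Then, for every $\epsilon>0$, the system $$i\partial_t h^\epsilon_n=-\tfrac12\operatorname{div}(\mathbb M_n^{-1}\nabla h^\epsilon_n)+\sum_{n'}e^{i\omega_{nn'}t/\epsilon^2}V_{nn'}h^\epsilon_{n'},\qquad h^\epsilon_n(0)=f^{in,\epsilon}_n,\qquad n\in\mathbb N,$$ and the decoupled system $$i\partial_t h_n=-\tfrac12\operatorname{div}(\mathbb M_n^{-1}\nabla h_n)+V_{nn}h_n,\qquad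 h_n(0)=f^{in}_n,\qquad n\in\mathbb N,$$ each have exactly one mild solution $h^\epsilon$, respectively $h$, in $C([0,\infty),\mathcal L^2)$ (a mild solution is a continuous function that satisfies the Duhamel formula with respect to the unitary groups $e^{\frac{it}{2}\operatorname{div}(\mathbb M_n^{-1}\nabla)}$), and $$\lim_{\epsilon\to0^+}\ \sup_{0\le t\le\tau}\|h^\epsilon(t)-h(t)\|_{\mathcal L^2}=0\qquad\text{for every }\tau\ge 0 .$$ -/

import Mathlib

open MeasureTheory Set Filter Topology FourierTransform
open scoped ENNReal NNReal ComplexConjugate SchwartzMap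

noncomputable section

/-- Position (and wave vector) space `ℝ^d` with the Euclidean norm. -/
abbrev Pos (d : ℕ) : Type := EuclideanSpace ℝ (Fin d)

/-- `L²(ℝ^d)`, complex valued. -/
abbrev L2Space (d : ℕ) : Type := Lp ℂ 2 (volume : Measure (Pos d))

/-- `ℓ²(ℕ, L²(ℝ^d))`, the space of sequences of envelope functions. -/
abbrev EnvSpace (d : ℕ) : Type := lp (fun _ : ℕ => L2Space d) 2

/-! ### The lattice and the Bloch functions at zero wave vector -/

/-- The lattice vector `L m`, `m ∈ ℤ^d`. -/
def latticeVec {d : ℕ} (L : Matrix (Fin d) (Fin d) ℝ) (m : Fin d → ℤ) : Pos d :=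
  WithLp.toLp 2 (L.mulVec fun i => (m i : ℝ))

/-- The centered fundamental cell `{L t | t ∈ [-1/2, 1/2]^d}`. -/
def cell {d : ℕ} (L : Matrix (Fin d) (Fin d) ℝ) : Set (Pos d) :=
  {z | ∃ t : Fin d → ℝ, (∀ i, t i ∈ Icc (-(1 / 2) : ℝ) (1 / 2)) ∧
    z = WithLp.toLp 2 (L.mulVec t)}

/-- Almost everywhere periodicity with respect to the lattice `L ℤ^d`. -/
def LatticePeriodic {d : ℕ} {F : Type*} (L : Matrix (Fin d) (Fin d) ℝ) (u : Pos d → F) : Prop :=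
  ∀ m : Fin d → ℤ, ∀ᵐ z : Pos d, u (z + latticeVec L m) = u z

/-- The partial derivative `∂_j φ` of a test function. -/
def partialDeriv {d : ℕ} (j : Fin d) (φ : Pos d → ℂ) (z : Pos d) : ℂ :=
  fderiv ℝ φ z (EuclideanSpace.single j 1)

/-- Smooth, compactly supported test functions on `ℝ^d`. -/
def IsTestFunction {d : ℕ} (φ : Pos d → ℂ) : Prop :=
  ContDiff ℝ (⊤ : ℕ∞) φ ∧ HasCompactSupport φ

/-- `Du` is the weak gradient of `u` on `ℝ^d`. -/
def HasWeakGradient {d : ℕ} (u : Pos d → ℂ) (Du : Fin d → Pos d → ℂ) : Prop :=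
  LocallyIntegrable u ∧ (∀ j, LocallyIntegrable (Du j)) ∧
    ∀ φ : Pos d → ℂ, IsTestFunction φ → ∀ j,
      (∫ z, u z * partialDeriv j φ z) = -(∫ z, Du j z * φ z)

/-- `(E n, v n)` is the complete system of eigenpairs of `-½ Δ + W` on the cell with periodic
boundary conditions, all eigenvalues being simple and listed in increasing order: the `v n` are
periodic, of class `H¹` on the cell with weak gradient `Dv n`, solve
`-½ Δ v n + W v n = E n v n` weakly, and form an orthonormal basis of `L²` of the cell. -/
structure IsBlochSystem {d : ℕ} (L : Matrix (Fin d) (Fin d) ℝ) (W : Pos d → ℝ)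
    (E : ℕ → ℝ) (v : ℕ → Pos d → ℂ) (Dv : ℕ → Fin d → Pos d → ℂ) : Prop where
  strictMono : StrictMono E
  periodic : ∀ n, LatticePeriodic L (v n)
  memLp : ∀ n, MemLp (v n) 2 (volume.restrict (cell L))
  weakGradient : ∀ n, HasWeakGradient (v n) (Dv n)
  memLp_gradient : ∀ n j, MemLp (Dv n j) 2 (volume.restrict (cell L))
  eigen : ∀ n, ∀ φ : Pos d → ℂ, IsTestFunction φ →
    (1 / 2 : ℂ) * (∑ j, ∫ z, Dv n j z * partialDeriv j φ z) + (∫ z, (W z : ℂ) * v n z * φ z)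
      = (E n : ℂ) * (∫ z, v n z * φ z)
  orthonormal : ∀ n m, ∫ z in cell L, conj (v n z) * v m z = if n = m then 1 else 0
  complete : ∀ f : Pos d → ℂ, MemLp f 2 (volume.restrict (cell L)) →
    (∀ n, ∫ z in cell L, conj (v n z) * f z = 0) → f =ᵐ[volume.restrict (cell L)] 0

/-- The `j`-th component of `P_{nm} = ∫_C conj(v_n) ∇ v_m`. -/
def momentumElement {d : ℕ} (L : Matrix (Fin d) (Fin d) ℝ) (v : ℕ → Pos d → ℂ)
    (Dv : ℕ → Fin d → Pos d → ℂ) (n m : ℕ) (j : Fin d) : ℂ :=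
  ∫ z in cell L, conj (v n z) * Dv m j z

/-- The inverse effective mass tensor of the `n`-th band,
`I - 2 ∑_{m ≠ n} P_{nm} ⊗ P_{mn} / (E_n - E_m)`. For a Bloch system its entries are real numbers,
since each `v n` is a real function up to a constant phase; `re` only changes their type. -/
def inverseMass {d : ℕ} (L : Matrix (Fin d) (Fin d) ℝ) (E : ℕ → ℝ) (v : ℕ → Pos d → ℂ)
    (Dv : ℕ → Fin d → Pos d → ℂ) (n : ℕ) : Matrix (Fin d) (Fin d) ℝ :=
  fun i j => ((if i = j then 1 else 0) - 2 * ∑' m : ℕ, if m = n then 0 else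
    momentumElement L v Dv n m i * momentumElement L v Dv m n j / ((E n : ℂ) - (E m : ℂ)) : ℂ).re

/-! ### The external potential -/

/-- The class `𝒲_μ` of external potentials `V(x, z)`: bounded on `ℝ^d × ℝ^d`, periodic in `z`, and
such that, for a.e. `z` in the cell, the (distributional) Fourier transform of `V(·, z)` is a
function with `∫ (1 + |k|)^μ |V̂(k, z)| dk` bounded uniformly in `z`. Here `G` is the Fourier
transform in the normalization `∫ e^{-2π i ξ·x} V(x, z) dx`, so that `k = 2π ξ`. -/
def MemPotentialClass {d : ℕ} (L : Matrix (Fin d) (Fin d) ℝ) (μ : ℝ)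
    (V : Pos d → Pos d → ℝ) : Prop :=
  MemLp (Function.uncurry V) ⊤ (volume : Measure (Pos d × Pos d)) ∧
  (∀ m : Fin d → ℤ, ∀ᵐ p : Pos d × Pos d, V p.1 (p.2 + latticeVec L m) = V p.1 p.2) ∧
  ∃ K : ℝ≥0, ∀ᵐ z ∂(volume.restrict (cell L)), ∃ G : Pos d → ℂ, Integrable G ∧
    (∀ φ : 𝓢(Pos d, ℂ), (∫ x, (V x z : ℂ) * (𝓕 φ) x) = ∫ ξ, G ξ * φ ξ) ∧
    (∫⁻ ξ, ENNReal.ofReal ((1 + 2 * Real.pi * ‖ξ‖) ^ μ) * ‖G ξ‖ₑ) ≤ K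

/-- The matrix potential `V_{nm}(x) = ∫_C conj(v_n(z)) v_m(z) V(x, z) dz`. -/
def potentialMatrix {d : ℕ} (L : Matrix (Fin d) (Fin d) ℝ) (v : ℕ → Pos d → ℂ)
    (V : Pos d → Pos d → ℝ) (n m : ℕ) (x : Pos d) : ℂ :=
  ∫ z in cell L, conj (v n z) * v m z * (V x z : ℂ)

/-! ### The evolution equations -/

/-- The squared norm of `ℓ²(ℕ, H^μ(ℝ^d))`, that is `∑_n ∫ (1 + |k|²)^μ |f̂_n(k)|² dk` with the
unitary Fourier transform in `k`, written in the variable `ξ = k / 2π`. -/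
def sobolevNormSq {d : ℕ} (μ : ℝ) (f : EnvSpace d) : ℝ≥0∞ :=
  ∑' n, ∫⁻ ξ, ENNReal.ofReal ((1 + ‖(2 * Real.pi) • ξ‖ ^ 2) ^ μ) *
    ‖(𝓕 (f n) : L2Space d) ξ‖ₑ ^ 2

open Classical in
/-- The pointwise product of an `L²` function with a bounded measurable function `a`
(zero if the product is not in `L²`, which does not happen for such `a`). -/
def mulL2 {d : ℕ} (a : Pos d → ℂ) (f : L2Space d) : L2Space d :=
  if h : MemLp (fun x => a x * f x) 2 volume then h.toLp _ else 0

/-- The unitary group `exp (i t/2 div(M ∇))` on `L²(ℝ^d)`, i.e. multiplication of the Fourier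
transform by `exp (-i t/2 k·M k)`, with `k = 2π ξ`. -/
def freeGroup {d : ℕ} (M : Matrix (Fin d) (Fin d) ℝ) (t : ℝ) (f : L2Space d) : L2Space d :=
  𝓕⁻ (mulL2 (fun ξ : Pos d => Complex.exp (-(Complex.I * (t / 2 : ℝ) *
    (((2 * Real.pi) • ξ).ofLp ⬝ᵥ M.mulVec ((2 * Real.pi) • ξ).ofLp : ℝ)))) (𝓕 f))

/-- `h : [0, ∞) → ℓ²(L²)` is a mild solution of the system
`i ∂_t h_n = -½ div(M_n ∇ h_n) + (B(t) h)_n`, `h(0) = f`: it is continuous and satisfies the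
variation of constants formula. -/
def IsMildSolution {d : ℕ} (M : ℕ → Matrix (Fin d) (Fin d) ℝ)
    (B : ℝ → EnvSpace d → ℕ → L2Space d) (f : EnvSpace d) (h : ℝ → EnvSpace d) : Prop :=
  ContinuousOn h (Ici 0) ∧ ∀ t, 0 ≤ t → ∀ n,
    h t n = freeGroup (M n) t (f n)
      - Complex.I • ∫ s in (0 : ℝ)..t, freeGroup (M n) (t - s) (B s (h s) n)

/-- The rapidly oscillating coupling
`(B^ε(t) h)_n = ∑_m exp(i (E_n - E_m) t / ε²) V_{nm} h_m`. -/
def oscillatingCoupling {d : ℕ} (E : ℕ → ℝ) (U : ℕ → ℕ → Pos d → ℂ) (ε : ℝ)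
    (t : ℝ) (h : EnvSpace d) (n : ℕ) : L2Space d :=
  ∑' m, Complex.exp (Complex.I * (((E n - E m) * t / ε ^ 2 : ℝ) : ℂ)) • mulL2 (U n m) (h m)

/-- The decoupled potential `(B h)_n = V_{nn} h_n`. -/
def diagonalCoupling {d : ℕ} (U : ℕ → ℕ → Pos d → ℂ)
    (_t : ℝ) (h : EnvSpace d) (n : ℕ) : L2Space d :=
  mulL2 (U n n) (h n)

/-- Existence, and uniqueness on `[0, ∞)`, of the mild solution. -/
def HasUniqueMildSolution {d : ℕ} (M : ℕ → Matrix (Fin d) (Fin d) ℝ)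
    (B : ℝ → EnvSpace d → ℕ → L2Space d) (f : EnvSpace d) : Prop :=
  ∃ h, IsMildSolution M B f h ∧ ∀ h', IsMildSolution M B f h' → EqOn h' h (Ici 0)

end

/-! The map `J : (f_n) ↦ ∑ f_n ⊗ v_n` is an isometry into `L²(ℝ^d × C)`, and the matrix `(V_{nm})`
is the compression `T = J* V J`, hence a bounded operator on `ℓ²(L²)`
(`compressedMultiplication_single`). With `D(s) = diag(exp(i E_n s))` the oscillating coupling is
`D(t/ε²) T D(-t/ε²)`, bounded by `‖T‖` for all `ε` and strongly continuous in `t`. In the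
interaction picture `y = U(-t) h`, Duhamel's formula therefore becomes a linear Volterra equation
with bounded coefficients, solved by a contraction argument.

For the limit, Gronwall's inequality reduces the claim to `∫₀ᵗ U(-s) (B^ε(s) - B) h(s) ds → 0`
uniformly on `[0, τ]` (`tendstoUniformlyOn_of_isMild`). The trajectory `h` does not depend on `ε`,
so uniform boundedness permits a truncation to finitely many input and output bands. What remains
are integrals with the phase `exp(i (E_n - E_m) s / ε²)`, `n ≠ m`, whose frequency is nonzero
because the eigenvalues are simple; they vanish by the Riemann-Lebesgue lemma
(`tendsto_integral_oscillatingOperator_sub`). -/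

noncomputable section

/-! ### Linear Volterra equations with strongly continuous bounded coefficients -/

section Volterra

variable {X Y : Type*} [NormedAddCommGroup X] [NormedSpace ℂ X]
  [NormedAddCommGroup Y] [NormedSpace ℂ Y]

/-- Split `A t (y t) = A t (y t - y t₀) + A t (y t₀)`: the uniform bound handles the first term,
strong continuity the second. -/
theorem continuous_apply_of_strongly_continuous {T : Type*} [TopologicalSpace T]
    {A : T → X →L[ℂ] Y} {C : ℝ} (hC : ∀ t, ‖A t‖ ≤ C)
    (hA : ∀ x, Continuous fun t => A t x) {y : T → X} (hy : Continuous y) :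
    Continuous fun t => A t (y t) := by
  rw [continuous_iff_continuousAt]
  intro t₀
  have h1 : Tendsto (fun t => A t (y t - y t₀)) (𝓝 t₀) (𝓝 0) := by
    refine squeeze_zero_norm (a := fun t => C * ‖y t - y t₀‖) (fun t => ?_) ?_
    · exact (A t).le_of_opNorm_le (hC t) _
    · have : Continuous fun t => C * ‖y t - y t₀‖ := by fun_prop
      simpa using this.tendsto t₀
  have h2 := h1.add ((hA (y t₀)).tendsto t₀)
  simpa [ContinuousAt] using h2

variable {A : ℝ → X →L[ℂ] X} {C : ℝ}

/-- The weight grows at twice the rate `C`, so the weighted Volterra operator has norm at most `C /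
(2C) = 1/2`, independently of the length of the time interval. -/
theorem norm_exp_smul_integral_le (hC0 : 0 < C) (hC : ∀ t, ‖A t‖ ≤ C) {z : ℝ → X} {K : ℝ}
    (hz : ∀ t, ‖z t‖ ≤ K) {p : ℝ} (hp : 0 ≤ p) :
    ‖Real.exp (-(2 * C * p)) • ∫ s in (0 : ℝ)..p, Real.exp (2 * C * s) • A s (z s)‖ ≤ K / 2 := by
  have hK : 0 ≤ K := (norm_nonneg _).trans (hz 0)
  have h1 : ‖∫ s in (0 : ℝ)..p, Real.exp (2 * C * s) • A s (z s)‖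
      ≤ ∫ s in (0 : ℝ)..p, Real.exp (2 * C * s) * (C * K) := by
    refine intervalIntegral.norm_integral_le_of_norm_le hp (ae_of_all _ fun s _ => ?_)
      (Continuous.intervalIntegrable (by fun_prop) _ _)
    rw [norm_smul, Real.norm_of_nonneg (Real.exp_pos _).le]
    gcongr
    exact ((A s).le_of_opNorm_le (hC s) _).trans (by gcongr; exact hz s)
  have h2 : ∫ s in (0 : ℝ)..p, Real.exp (2 * C * s) * (C * K)
      = (Real.exp (2 * C * p) - 1) * (K / 2) := by
    rw [intervalIntegral.integral_mul_const, intervalIntegral.integral_comp_mul_left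
      (fun s => Real.exp s) (by positivity : 2 * C ≠ 0), integral_exp]
    simp
    field_simp
  rw [norm_smul, Real.norm_of_nonneg (Real.exp_pos _).le]
  calc _ ≤ Real.exp (-(2 * C * p)) * ((Real.exp (2 * C * p) - 1) * (K / 2)) := by
        gcongr; exact h1.trans_eq h2
    _ = (1 - Real.exp (-(2 * C * p))) * (K / 2) := by
        rw [← mul_assoc, mul_sub, ← Real.exp_add]; simp
    _ ≤ 1 * (K / 2) := by
        gcongr
        linarith [Real.exp_pos (-(2 * C * p))]
    _ = K / 2 := one_mul _

/-- Banach's fixed point theorem for the weighted unknown `z t = exp(-2Ct) y t`, which is bounded on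
the half-line; this gives a global solution without gluing. -/
theorem exists_volterra_solution [CompleteSpace X] (hC : ∀ t, ‖A t‖ ≤ C)
    (hA : ∀ x, Continuous fun t => A t x) (f : X) :
    ∃ y : ℝ → X, Continuous y ∧ ∀ t, 0 ≤ t → y t = f + ∫ s in (0 : ℝ)..t, A s (y s) := by
  wlog hC0 : 0 < C generalizing C
  · exact this (C := |C| + 1) (fun t => (hC t).trans (by linarith [le_abs_self C])) (by positivity)
  have hexp : Continuous fun s : ℝ => Real.exp (2 * C * s) := by fun_prop
  have hexp' : Continuous fun t : ℝ => Real.exp (-(2 * C * max t 0)) := by fun_prop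
  have hcont : ∀ z : ℝ → X, Continuous z →
      Continuous fun s => Real.exp (2 * C * s) • A s (z s) := fun z hz =>
    hexp.smul (continuous_apply_of_strongly_continuous hC hA hz)
  -- Freezing time at `max t 0` keeps everything bounded for negative `t`, so that the fixed point
  -- can be sought among bounded continuous functions on all of `ℝ`.
  let Ψ : (ℝ → X) → ℝ → X := fun z t => Real.exp (-(2 * C * max t 0)) •
    ∫ s in (0 : ℝ)..max t 0, Real.exp (2 * C * s) • A s (z s)
  have hΨ : ∀ z, Continuous z → Continuous (Ψ z) := fun z hz => by
    have hmax : Continuous fun t : ℝ => max t 0 := by fun_prop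
    exact hexp'.smul ((intervalIntegral.continuous_primitive
      (fun a b => (hcont z hz).intervalIntegrable a b) 0).comp hmax)
  have hΨb : ∀ z : BoundedContinuousFunction ℝ X, ∀ t, ‖Ψ z t‖ ≤ ‖z‖ / 2 := fun z t =>
    norm_exp_smul_integral_le hC0 hC z.norm_coe_le_norm (le_max_right _ _)
  have hf : ∀ t : ℝ, ‖Real.exp (-(2 * C * max t 0)) • f‖ ≤ ‖f‖ := fun t => by
    rw [norm_smul, Real.norm_of_nonneg (Real.exp_pos _).le]
    refine mul_le_of_le_one_left (norm_nonneg _) (Real.exp_le_one_iff.2 ?_)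
    have : 0 ≤ max t 0 := le_max_right _ _
    simp; positivity
  let Φ : BoundedContinuousFunction ℝ X → BoundedContinuousFunction ℝ X := fun z =>
    BoundedContinuousFunction.ofNormedAddCommGroup
      (fun t => Real.exp (-(2 * C * max t 0)) • f + Ψ z t)
      ((hexp'.smul continuous_const).add (hΨ z z.continuous)) (‖f‖ + ‖z‖ / 2)
      (fun t => (norm_add_le _ _).trans (add_le_add (hf t) (hΨb z t)))
  have hΦ : ContractingWith (1 / 2) Φ := by
    refine ⟨by rw [← NNReal.coe_lt_coe]; norm_num, LipschitzWith.of_dist_le_mul fun z w => ?_⟩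
    rw [BoundedContinuousFunction.dist_le (by positivity)]
    intro t
    have : Φ z t - Φ w t = Ψ (z - w) t := by
      simp only [Φ, Ψ, BoundedContinuousFunction.coe_ofNormedAddCommGroup, add_sub_add_left_eq_sub]
      rw [← smul_sub, ← intervalIntegral.integral_sub
        ((hcont z z.continuous).intervalIntegrable _ _)
        ((hcont w w.continuous).intervalIntegrable _ _)]
      simp [smul_sub]
    rw [dist_eq_norm, this, dist_eq_norm]
    exact (hΨb (z - w) t).trans_eq (by simp; ring)
  obtain ⟨z, hz⟩ : ∃ z, Φ z = z := ⟨_, hΦ.fixedPoint_isFixedPt⟩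
  have hzt : ∀ t, 0 ≤ t → Real.exp (2 * C * t) • z t
      = f + ∫ s in (0 : ℝ)..t, Real.exp (2 * C * s) • A s (z s) := fun t ht => by
    conv_lhs => rw [← hz]
    simp only [Φ, Ψ, BoundedContinuousFunction.coe_ofNormedAddCommGroup, max_eq_left ht,
      smul_add, smul_smul, ← Real.exp_add]
    simp
  refine ⟨fun t => Real.exp (2 * C * t) • z t, hexp.smul z.continuous, fun t ht => (hzt t ht).trans ?_⟩
  congr 1
  refine intervalIntegral.integral_congr fun s _ => ?_
  exact ((A s).map_smul_of_tower _ _).symm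

theorem norm_le_of_volterra_inequality [CompleteSpace X] (hC0 : 0 < C) (hC : ∀ t, ‖A t‖ ≤ C)
    (hA : ∀ x, Continuous fun t => A t x) {w r : ℝ → X} (hw : Continuous w) {δ τ : ℝ}
    (hr : ∀ t ∈ Icc 0 τ, ‖r t‖ ≤ δ)
    (heq : ∀ t ∈ Icc 0 τ, w t = r t + ∫ s in (0 : ℝ)..t, A s (w s)) :
    ∀ t ∈ Icc 0 τ, ‖w t‖ ≤ δ * Real.exp (C * t) := by
  have hAw := continuous_apply_of_strongly_continuous hC hA hw
  have hd : ∀ t, HasDerivAt (fun t => ∫ s in (0 : ℝ)..t, A s (w s)) (A t (w t)) t := fun t =>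
    intervalIntegral.integral_hasDerivAt_right (hAw.intervalIntegrable _ _)
      (hAw.stronglyMeasurableAtFilter _ _) hAw.continuousAt
  -- Gronwall is applied to the integral instead of `w`, since `r` need not be differentiable. The
  -- integral is then at most `δ (exp(Ct) - 1)`, and adding `‖r t‖ ≤ δ` gives the claim.
  have hgr := norm_le_gronwallBound_of_norm_deriv_right_le (a := 0) (b := τ) (δ := 0) (K := C)
    (ε := C * δ) (f := fun t => ∫ s in (0 : ℝ)..t, A s (w s)) (f' := fun t => A t (w t))
    (fun t _ => (hd t).continuousAt.continuousWithinAt) (fun t _ => (hd t).hasDerivWithinAt)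
    (by simp) (fun t ht => by
      have ht' : t ∈ Icc 0 τ := ⟨ht.1, ht.2.le⟩
      calc ‖A t (w t)‖ ≤ C * ‖w t‖ := (A t).le_of_opNorm_le (hC t) _
        _ ≤ C * (δ + ‖∫ s in (0 : ℝ)..t, A s (w s)‖) := by
          gcongr
          conv_lhs => rw [heq t ht']
          exact (norm_add_le _ _).trans (by gcongr; exact hr t ht')
        _ = _ := by ring)
  intro t ht
  have h1 := hgr t ht
  rw [gronwallBound_of_K_ne_0 hC0.ne'] at h1
  simp only [sub_zero, zero_mul, zero_add, mul_div_cancel_left₀ _ hC0.ne'] at h1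
  rw [heq t ht]
  refine (norm_add_le _ _).trans ?_
  linarith [hr t ht]

end Volterra

/-! ### Averaging of oscillating integrals -/

section Averaging

/-- A common Lipschitz constant carries smallness at one time to a neighbourhood; compactness of the
interval does the rest. -/
theorem tendstoUniformlyOn_zero_of_lipschitz {X ι : Type*} [NormedAddCommGroup X] {l : Filter ι}
    {F : ι → ℝ → X} {K τ : ℝ}
    (hF : ∀ i, ∀ s ∈ Icc 0 τ, ∀ t ∈ Icc 0 τ, ‖F i t - F i s‖ ≤ K * |t - s|)
    (hlim : ∀ t ∈ Icc 0 τ, Tendsto (fun i => F i t) l (𝓝 0)) :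
    TendstoUniformlyOn F 0 l (Icc 0 τ) := by
  rw [← tendstoLocallyUniformlyOn_iff_tendstoUniformlyOn_of_compact isCompact_Icc,
    Metric.tendstoLocallyUniformlyOn_iff]
  intro η hη s hs
  have hnear : ∀ᶠ t in 𝓝 s, K * |t - s| < η / 2 := by
    have hc : Continuous fun t => K * |t - s| := by fun_prop
    exact hc.tendsto s |>.eventually_lt_const (by simpa using half_pos hη)
  refine ⟨{t | K * |t - s| < η / 2} ∩ Icc 0 τ,
    inter_mem (mem_nhdsWithin_of_mem_nhds hnear) self_mem_nhdsWithin, ?_⟩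
  filter_upwards [(hlim s hs).norm.eventually_lt_const
    (by simpa using half_pos hη : ‖(0 : X)‖ < η / 2)] with i hi
  rintro t ⟨ht, htI⟩
  have h := hF i s hs t htI
  have ht' : K * |t - s| < η / 2 := ht
  rw [Pi.zero_apply, dist_zero_left]
  have h3 : ‖F i t‖ ≤ ‖F i t - F i s‖ + ‖F i s‖ := by
    simpa using norm_add_le (F i t - F i s) (F i s)
  linarith

theorem tendsto_integral_exp_smul_nhdsGT {X : Type*} [NormedAddCommGroup X] [NormedSpace ℂ X]
    (g : ℝ → X) {ω : ℝ} (hω : ω ≠ 0) {t : ℝ} (ht : 0 ≤ t) :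
    Tendsto (fun ε : ℝ => ∫ s in (0 : ℝ)..t,
      Complex.exp (Complex.I * ((ω * (s / ε ^ 2) : ℝ) : ℂ)) • g s) (𝓝[>] 0) (𝓝 0) := by
  have h1 : Tendsto (fun ε : ℝ => ‖-(ω / (2 * Real.pi)) * (ε ^ 2)⁻¹‖) (𝓝[>] 0) atTop := by
    have h2 : Tendsto (fun ε : ℝ => (ε ^ 2)⁻¹) (𝓝[>] 0) atTop := by
      refine tendsto_inv_nhdsGT_zero.comp ?_
      refine tendsto_nhdsWithin_iff.2 ⟨?_, ?_⟩
      · have : Continuous fun ε : ℝ => ε ^ 2 := by fun_prop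
        exact (by simpa using this.tendsto 0 : Tendsto _ _ _).mono_left nhdsWithin_le_nhds
      · filter_upwards [self_mem_nhdsWithin] with ε hε
        exact pow_pos (mem_Ioi.1 hε) 2
    have h3 : 0 < |ω / (2 * Real.pi)| := by positivity
    refine (h2.const_mul_atTop h3).congr fun ε => ?_
    rw [Real.norm_eq_abs, abs_mul, abs_neg, abs_of_nonneg (inv_nonneg.2 (sq_nonneg ε))]
  -- Riemann-Lebesgue for `g` cut off to `(0, t]`, at the frequency `-ω / (2π ε²)`, which leaves
  -- every compact set. Integrability of `g` is not needed: otherwise the integrals are `0` by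
  -- convention.
  have h4 := (Real.tendsto_integral_exp_smul_cocompact ((Ioc 0 t).indicator g)).comp
    ((tendsto_norm_atTop_iff_cobounded.1 h1).mono_right
      (Metric.cobounded_eq_cocompact (α := ℝ)).le)
  refine h4.congr fun ε => ?_
  rw [Function.comp_apply, intervalIntegral.integral_of_le ht,
    ← integral_indicator measurableSet_Ioc]
  refine integral_congr_ae (ae_of_all _ fun s => ?_)
  by_cases hs : s ∈ Ioc 0 t
  · simp only [indicator_of_mem hs, Circle.smul_def, Real.fourierChar_apply]
    congr 2
    push_cast
    field_simp
  · simp [indicator_of_notMem hs]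

variable {G : ℕ → Type*} [∀ n, NormedAddCommGroup (G n)] [∀ n, NormedSpace ℂ (G n)]

/-- The finite truncations of `q` converge to it in `L¹(0, t)` by dominated convergence, so the
uniform operator bound makes the tail small uniformly in `i`. It serves twice in the averaging: for
the input bands and for the output bands. -/
theorem tendsto_integral_of_tendsto_integral_single {X ι : Type*} [NormedAddCommGroup X]
    [NormedSpace ℂ X] {l : Filter ι} {S : ι → ℝ → lp G 2 →L[ℂ] X} {C : ℝ}
    (hC : ∀ i s, ‖S i s‖ ≤ C) (hS : ∀ i x, Continuous fun s => S i s x) {t : ℝ} (ht : 0 ≤ t)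
    (hsingle : ∀ m (q : ℝ → G m), Continuous q →
      Tendsto (fun i => ∫ s in (0 : ℝ)..t, S i s (lp.single 2 m (q s))) l (𝓝 0))
    {q : ℝ → lp G 2} (hq : Continuous q) :
    Tendsto (fun i => ∫ s in (0 : ℝ)..t, S i s (q s)) l (𝓝 0) := by
  rcases isEmpty_or_nonempty ι with hι | ⟨⟨i₀⟩⟩
  · exact tendsto_of_isEmpty
  have hC0 : 0 ≤ C := (norm_nonneg _).trans (hC i₀ 0)
  have hqm : ∀ m, Continuous fun s => q s m := fun m => (lp.evalCLM ℂ G 2 m).continuous.comp hq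
  have hsq : ∀ m, Continuous fun s => lp.single 2 m (q s m) := fun m =>
    (lp.isometry_single (E := G) (p := 2) m).continuous.comp (hqm m)
  let Q : ℕ → ℝ → lp G 2 := fun N s => ∑ m ∈ Finset.range N, lp.single 2 m (q s m)
  have hQ : ∀ N, Continuous (Q N) := fun N => continuous_finsetSum _ fun m _ => hsq m
  have htail : ∀ N s, ‖q s - Q N s‖ ≤ ‖q s‖ := fun N s => by
    have h := lp.norm_compl_sum_single (p := 2) (by norm_num) (q s) (Finset.range N)
    have hsum : 0 ≤ ∑ i ∈ Finset.range N, ‖q s i‖ ^ (2 : ℝ≥0∞).toReal := by positivity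
    simp only [ENNReal.toReal_ofNat, Real.rpow_ofNat] at h hsum
    exact le_of_sq_le_sq (by simpa [Q] using (by linarith : _ ≤ ‖q s‖ ^ 2)) (norm_nonneg _)
  have hN : Tendsto (fun N => ∫ s in (0 : ℝ)..t, ‖q s - Q N s‖) atTop (𝓝 0) := by
    have h := intervalIntegral.tendsto_integral_filter_of_dominated_convergence
      (μ := volume) (a := 0) (b := t) (l := atTop) (F := fun N s => ‖q s - Q N s‖)
      (f := fun _ => 0) (fun s => ‖q s‖)
      (Eventually.of_forall fun N => (hq.sub (hQ N)).norm.aestronglyMeasurable)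
      (Eventually.of_forall fun N => ae_of_all _ fun s _ => by simpa using htail N s)
      (hq.norm.intervalIntegrable _ _)
      (ae_of_all _ fun s _ => by
        have h := (lp.hasSum_single (by norm_num) (q s)).tendsto_sum_nat
        simpa [Q] using (tendsto_const_nhds (x := q s)).sub h |>.norm)
    simpa using h
  have hQlim : ∀ N, Tendsto (fun i => ∫ s in (0 : ℝ)..t, S i s (Q N s)) l (𝓝 0) := fun N => by
    have h := tendsto_finsetSum (Finset.range N) fun m _ => hsingle m _ (hqm m)
    simp only [Finset.sum_const_zero] at h
    refine h.congr fun i => ?_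
    rw [← intervalIntegral.integral_finsetSum fun m _ =>
      (continuous_apply_of_strongly_continuous (hC i) (hS i) (hsq m)).intervalIntegrable _ _]
    simp [Q]
  rw [Metric.tendsto_nhds]
  intro η hη
  obtain ⟨N, hN'⟩ := ((hN.const_mul C).eventually_lt_const
    (by simpa using half_pos hη : C * 0 < η / 2)).exists
  filter_upwards [(hQlim N).norm.eventually_lt_const
    (by simpa using half_pos hη : ‖(0 : X)‖ < η / 2)] with i hi
  have hsplit : ∫ s in (0 : ℝ)..t, S i s (q s)
      = (∫ s in (0 : ℝ)..t, S i s (q s - Q N s)) + ∫ s in (0 : ℝ)..t, S i s (Q N s) := by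
    rw [← intervalIntegral.integral_add
      ((continuous_apply_of_strongly_continuous (hC i) (hS i)
        (y := fun s => q s - Q N s) (hq.sub (hQ N))).intervalIntegrable _ _)
      ((continuous_apply_of_strongly_continuous (hC i) (hS i) (hQ N)).intervalIntegrable _ _)]
    simp
  have hbound : ‖∫ s in (0 : ℝ)..t, S i s (q s - Q N s)‖
      ≤ C * ∫ s in (0 : ℝ)..t, ‖q s - Q N s‖ := by
    rw [← intervalIntegral.integral_const_mul]
    exact intervalIntegral.norm_integral_le_of_norm_le ht
      (ae_of_all _ fun s _ => (S i s).le_of_opNorm_le (hC i s) _)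
      (((hq.sub (hQ N)).norm.const_mul C).intervalIntegrable _ _)
  rw [dist_zero_right, hsplit]
  refine (norm_add_le _ _).trans_lt ?_
  linarith

end Averaging

/-! ### Mild solutions with respect to a contraction group -/

section MildSolutions

variable {X : Type*} [NormedAddCommGroup X] [NormedSpace ℂ X]

/-- A strongly continuous one-parameter group of contractions. -/
structure IsContractionGroup (U : ℝ → X →L[ℂ] X) : Prop where
  zero : ∀ x, U 0 x = x
  add : ∀ s t x, U (s + t) x = U s (U t x)
  norm_le : ∀ t, ‖U t‖ ≤ 1
  continuous : ∀ x, Continuous fun t => U t x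

namespace IsContractionGroup

variable {U : ℝ → X →L[ℂ] X}

theorem norm_apply_le (hU : IsContractionGroup U) (t : ℝ) (x : X) : ‖U t x‖ ≤ ‖x‖ := by
  simpa using (U t).le_of_opNorm_le (hU.norm_le t) x

theorem apply_neg_apply (hU : IsContractionGroup U) (t : ℝ) (x : X) : U t (U (-t) x) = x := by
  rw [← hU.add, add_neg_cancel, hU.zero]

theorem neg_apply_apply (hU : IsContractionGroup U) (t : ℝ) (x : X) : U (-t) (U t x) = x := by
  rw [← hU.add, neg_add_cancel, hU.zero]

theorem continuous_apply (hU : IsContractionGroup U) {T : Type*} [TopologicalSpace T]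
    {a : T → ℝ} (ha : Continuous a) {y : T → X} (hy : Continuous y) : Continuous fun t => U (a t) (y t) :=
  continuous_apply_of_strongly_continuous (A := fun t => U (a t)) (fun t => hU.norm_le (a t))
    (fun x => (hU.continuous x).comp ha) hy

end IsContractionGroup

/-- Mild solutions of `h' = (generator of U) h - i B(t) h`, `h(0) = f`. -/
def IsMild (U B : ℝ → X →L[ℂ] X) (f : X) (h : ℝ → X) : Prop :=
  ContinuousOn h (Ici 0) ∧ ∀ t, 0 ≤ t →
    h t = U t f - Complex.I • ∫ s in (0 : ℝ)..t, U (t - s) (B s (h s))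

/-- The generator `-i U(-s) B(s) U(s)` of the evolution in the interaction picture. -/
def interactionGenerator (U B : ℝ → X →L[ℂ] X) (s : ℝ) : X →L[ℂ] X :=
  -Complex.I • (U (-s)).comp ((B s).comp (U s))

variable {U B : ℝ → X →L[ℂ] X} {C : ℝ}

theorem interactionGenerator_apply (s : ℝ) (x : X) :
    interactionGenerator U B s x = -Complex.I • U (-s) (B s (U s x)) := rfl

theorem norm_interactionGenerator_le (hU : IsContractionGroup U) (hC : ∀ t, ‖B t‖ ≤ C) (s : ℝ) :
    ‖interactionGenerator U B s‖ ≤ C := by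
  have hC0 : 0 ≤ C := (norm_nonneg _).trans (hC 0)
  refine ContinuousLinearMap.opNorm_le_bound _ hC0 fun x => ?_
  rw [interactionGenerator_apply, norm_smul, norm_neg, Complex.norm_I, one_mul]
  exact (hU.norm_apply_le _ _).trans (((B s).le_of_opNorm_le (hC s) _).trans
    (by gcongr; exact hU.norm_apply_le _ _))

theorem continuous_interactionGenerator (hU : IsContractionGroup U) (hC : ∀ t, ‖B t‖ ≤ C)
    (hB : ∀ x, Continuous fun t => B t x) (x : X) :
    Continuous fun s => interactionGenerator U B s x :=
  (hU.continuous_apply continuous_neg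
    (continuous_apply_of_strongly_continuous hC hB (hU.continuous x))).const_smul _

/-- By the group law `U (t - s) = U t U (-s)`, the factor `U t` can be taken out of the Duhamel
integral. -/
theorem smul_integral_eq_apply_integral [CompleteSpace X] (hU : IsContractionGroup U)
    (hC : ∀ t, ‖B t‖ ≤ C) (hB : ∀ x, Continuous fun t => B t x) {y h : ℝ → X} (hy : Continuous y)
    (hyh : ∀ t, 0 ≤ t → h t = U t (y t)) {t : ℝ} (ht : 0 ≤ t) :
    -(Complex.I • ∫ s in (0 : ℝ)..t, U (t - s) (B s (h s)))
      = U t (∫ s in (0 : ℝ)..t, interactionGenerator U B s (y s)) := by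
  have hc := continuous_apply_of_strongly_continuous (norm_interactionGenerator_le hU hC)
    (continuous_interactionGenerator hU hC hB) hy
  rw [← (U t).intervalIntegral_comp_comm (hc.intervalIntegrable _ _), ← neg_smul,
    ← intervalIntegral.integral_smul]
  refine intervalIntegral.integral_congr fun s hs => ?_
  rw [uIcc_of_le ht] at hs
  simp only [interactionGenerator_apply, map_smul, hyh s hs.1, sub_eq_add_neg, hU.add]

theorem IsMild.exists_volterra [CompleteSpace X] (hU : IsContractionGroup U)
    (hC : ∀ t, ‖B t‖ ≤ C) (hB : ∀ x, Continuous fun t => B t x) {f : X} {h : ℝ → X}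
    (hh : IsMild U B f h) :
    ∃ y : ℝ → X, Continuous y ∧ (∀ t, 0 ≤ t → h t = U t (y t)) ∧
      ∀ t, 0 ≤ t → y t = f + ∫ s in (0 : ℝ)..t, interactionGenerator U B s (y s) := by
  have hmax : Continuous fun t : ℝ => max t 0 := by fun_prop
  -- A mild solution is constrained only for `t ≥ 0`; `max t 0` turns `U (-t) (h t)` into a function
  -- continuous on all of `ℝ`.
  have hy : Continuous fun t => U (-max t 0) (h (max t 0)) :=
    hU.continuous_apply hmax.neg
      (hh.1.comp_continuous hmax fun t => mem_Ici.2 (le_max_right _ _))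
  have hyh : ∀ t, 0 ≤ t → h t = U t (U (-max t 0) (h (max t 0))) := fun t ht => by
    rw [max_eq_left ht, hU.apply_neg_apply]
  refine ⟨_, hy, hyh, fun t ht => ?_⟩
  have h1 := hh.2 t ht
  rw [sub_eq_add_neg, smul_integral_eq_apply_integral hU hC hB hy hyh ht, ← map_add] at h1
  simp only [max_eq_left ht]
  rw [h1, hU.neg_apply_apply]

theorem exists_isMild [CompleteSpace X] (hU : IsContractionGroup U)
    (hC : ∀ t, ‖B t‖ ≤ C) (hB : ∀ x, Continuous fun t => B t x) (f : X) :
    ∃ h, IsMild U B f h := by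
  obtain ⟨y, hy, hyt⟩ := exists_volterra_solution (norm_interactionGenerator_le hU hC)
    (continuous_interactionGenerator hU hC hB) f
  refine ⟨fun t => U t (y t), (hU.continuous_apply continuous_id hy).continuousOn, fun t ht => ?_⟩
  rw [sub_eq_add_neg, smul_integral_eq_apply_integral hU hC hB hy (fun _ _ => rfl) ht, ← map_add,
    ← hyt t ht]

/-- Mild solutions depend continuously on the coupling, in the sense of time averages. -/
theorem tendstoUniformlyOn_of_isMild [CompleteSpace X] {ι : Type*} {l : Filter ι}
    (hU : IsContractionGroup U) {Bs : ι → ℝ → X →L[ℂ] X}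
    (hCs : ∀ i t, ‖Bs i t‖ ≤ C) (hBs : ∀ i x, Continuous fun t => Bs i t x)
    (hC : ∀ t, ‖B t‖ ≤ C) (hB : ∀ x, Continuous fun t => B t x)
    (havg : ∀ q : ℝ → X, Continuous q → ∀ t, 0 ≤ t →
      Tendsto (fun i => ∫ s in (0 : ℝ)..t, U (-s) ((Bs i s - B s) (q s))) l (𝓝 0))
    {fs : ι → X} {f : X} (hf : Tendsto (fun i => ‖fs i - f‖) l (𝓝 0))
    {hs : ι → ℝ → X} {h : ℝ → X} (hhs : ∀ᶠ i in l, IsMild U (Bs i) (fs i) (hs i))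
    (hh : IsMild U B f h) (τ : ℝ) : TendstoUniformlyOn hs h l (Icc 0 τ) := by
  wlog hC0 : 0 < C generalizing C
  · exact this (C := |C| + 1) (fun i t => (hCs i t).trans (by linarith [le_abs_self C]))
      (fun t => (hC t).trans (by linarith [le_abs_self C])) (by positivity)
  obtain ⟨y, hy, hyh, hyt⟩ := hh.exists_volterra hU hC hB
  have hcA := fun i z hz => continuous_apply_of_strongly_continuous (y := z)
    (norm_interactionGenerator_le hU (hCs i))
    (continuous_interactionGenerator hU (hCs i) (hBs i)) hz
  have hcB := fun z hz => continuous_apply_of_strongly_continuous (y := z)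
    (norm_interactionGenerator_le hU hC) (continuous_interactionGenerator hU hC hB) hz
  -- The difference of the generators is evaluated along the limit trajectory `y`, which does not
  -- depend on `i`; this is why averaging along fixed curves suffices.
  let R : ι → ℝ → X := fun i s =>
    interactionGenerator U (Bs i) s (y s) - interactionGenerator U B s (y s)
  have hR : ∀ i, Continuous (R i) := fun i => (hcA i y hy).sub (hcB y hy)
  obtain ⟨M, hM⟩ := isCompact_Icc.exists_bound_of_continuousOn (s := Icc 0 τ) hy.continuousOn
  have hunif : TendstoUniformlyOn (fun i t => ∫ s in (0 : ℝ)..t, R i s) 0 l (Icc 0 τ) := by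
    refine tendstoUniformlyOn_zero_of_lipschitz (K := 2 * C * M) (fun i s hs t ht => ?_)
      fun t ht => ?_
    · rw [intervalIntegral.integral_interval_sub_left ((hR i).intervalIntegrable _ _)
        ((hR i).intervalIntegrable _ _)]
      refine intervalIntegral.norm_integral_le_of_norm_le_const fun r hr => ?_
      have hr' : r ∈ Icc 0 τ := uIcc_subset_Icc hs ht (uIoc_subset_uIcc hr)
      have h1 := (interactionGenerator U (Bs i) r).le_of_opNorm_le
        (norm_interactionGenerator_le hU (hCs i) r) (y r)
      have h2 := (interactionGenerator U B r).le_of_opNorm_le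
        (norm_interactionGenerator_le hU hC r) (y r)
      have h3 := mul_le_mul_of_nonneg_left (hM r hr') hC0.le
      exact (norm_sub_le _ _).trans (by linarith)
    · have h1 := (havg _ (hU.continuous_apply continuous_id hy) t ht.1).const_smul (-Complex.I)
      rw [smul_zero] at h1
      refine h1.congr fun i => ?_
      rw [← intervalIntegral.integral_smul]
      refine intervalIntegral.integral_congr fun s _ => ?_
      simp only [R, interactionGenerator_apply, id, sub_apply, map_sub,
        smul_sub]
  rw [Metric.tendstoUniformlyOn_iff] at hunif ⊢
  intro η hη
  -- The initial error and the averaged forcing each contribute at most this much; after the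
  -- Gronwall factor `exp(Cτ)` the total is `2η/3 < η`.
  have hδ : 0 < η * Real.exp (-(C * τ)) / 3 := by positivity
  filter_upwards [hhs, hunif _ hδ, hf.eventually_lt_const hδ] with i hi hri hfi t ht
  obtain ⟨z, hz, hzh, hzt⟩ := hi.exists_volterra hU (hCs i) (hBs i)
  have hgr := norm_le_of_volterra_inequality hC0 (norm_interactionGenerator_le hU (hCs i))
    (continuous_interactionGenerator hU (hCs i) (hBs i)) (w := fun t => z t - y t)
    (r := fun t => (fs i - f) + ∫ s in (0 : ℝ)..t, R i s) (τ := τ)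
    (δ := 2 * (η * Real.exp (-(C * τ)) / 3)) (hz.sub hy)
    (fun t ht => by
      have h1 := hri t ht
      rw [Pi.zero_apply, dist_zero_left] at h1
      exact (norm_add_le _ _).trans (by linarith))
    (fun t ht => by
      -- With `A_i`, `A` the two interaction generators, `A_i z - A y = R + A_i (z - y)`.
      rw [hzt t ht.1, hyt t ht.1, add_assoc, ← intervalIntegral.integral_add
        ((hR i).intervalIntegrable _ _) ((hcA i (fun s => z s - y s) (hz.sub hy)).intervalIntegrable _ _),
        add_sub_add_comm, ← intervalIntegral.integral_sub ((hcA i z hz).intervalIntegrable _ _)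
        ((hcB y hy).intervalIntegrable _ _)]
      congr 1
      refine intervalIntegral.integral_congr fun s _ => ?_
      simp [R]) t ht
  rw [dist_eq_norm, hyh t ht.1, hzh t ht.1, ← map_sub, ← norm_neg, ← map_neg, neg_sub]
  calc ‖U t (z t - y t)‖ ≤ ‖z t - y t‖ := hU.norm_apply_le _ _
    _ ≤ 2 * (η * Real.exp (-(C * τ)) / 3) * Real.exp (C * t) := hgr
    _ ≤ 2 * (η * Real.exp (-(C * τ)) / 3) * Real.exp (C * τ) := by
        gcongr; exact ht.2
    _ = 2 * η / 3 * (Real.exp (-(C * τ)) * Real.exp (C * τ)) := by ring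
    _ = 2 * η / 3 := by rw [← Real.exp_add]; simp
    _ < η := by linarith

/-- Stability applied to a constant family: the constant sequence `h'` converges to `h`. -/
theorem IsMild.eqOn [CompleteSpace X] (hU : IsContractionGroup U)
    (hC : ∀ t, ‖B t‖ ≤ C) (hB : ∀ x, Continuous fun t => B t x) {f : X} {h h' : ℝ → X}
    (hh : IsMild U B f h) (hh' : IsMild U B f h') : EqOn h' h (Ici 0) := by
  intro t ht
  have hlim := tendstoUniformlyOn_of_isMild (ι := ℕ) (l := atTop) hU (Bs := fun _ => B)
    (fun _ => hC) (fun _ => hB) hC hB (fun q _ t _ => by simp) (fs := fun _ => f) (f := f)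
    (by simp) (hs := fun _ => h') (Eventually.of_forall fun _ => hh') hh t
  exact tendsto_nhds_unique tendsto_const_nhds (hlim.tendsto_at (right_mem_Icc.2 ht))

end MildSolutions

/-! ### Diagonal operators on `ℓ²` direct sums -/

section Diagonal

variable {G : ℕ → Type*} [∀ n, NormedAddCommGroup (G n)]

theorem lp.norm_sq_eq_tsum (h : lp G 2) : ‖h‖ ^ 2 = ∑' n, ‖h n‖ ^ 2 := by
  simpa using lp.norm_rpow_eq_tsum (p := 2) (by norm_num) h

theorem lp.summable_norm_sq (h : lp G 2) : Summable fun n => ‖h n‖ ^ 2 := by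
  simpa using (lp.hasSum_norm (p := 2) (by norm_num) h).summable

variable [∀ n, NormedSpace ℂ (G n)]

theorem norm_sq_apply_le (A : ∀ n, G n →L[ℂ] G n) {C : ℝ} (hC : ∀ n, ‖A n‖ ≤ C) (h : lp G 2)
    (n : ℕ) : ‖A n (h n)‖ ^ 2 ≤ C ^ 2 * ‖h n‖ ^ 2 := by
  rw [← mul_pow]
  gcongr
  exact (A n).le_of_opNorm_le (hC n) _

theorem memℓp_diagonal (A : ∀ n, G n →L[ℂ] G n) {C : ℝ} (hC : ∀ n, ‖A n‖ ≤ C) (h : lp G 2) :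
    Memℓp (fun n => A n (h n)) 2 :=
  memℓp_gen (by
    simpa using Summable.of_nonneg_of_le (fun n => by positivity) (norm_sq_apply_le A hC h)
      ((lp.summable_norm_sq h).mul_left _))

/-- The diagonal linear map on an `ℓ²` direct sum with uniformly bounded entries. -/
def lpDiagonalₗ (A : ∀ n, G n →L[ℂ] G n) {C : ℝ} (hC : ∀ n, ‖A n‖ ≤ C) : lp G 2 →ₗ[ℂ] lp G 2 where
  toFun h := ⟨fun n => A n (h n), memℓp_diagonal A hC h⟩
  map_add' h k := by ext n; exact (A n).map_add _ _
  map_smul' c h := by ext n; exact (A n).map_smul _ _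

theorem norm_lpDiagonalₗ_apply_le (A : ∀ n, G n →L[ℂ] G n) {C : ℝ} (hC : ∀ n, ‖A n‖ ≤ C)
    (h : lp G 2) : ‖lpDiagonalₗ A hC h‖ ≤ C * ‖h‖ := by
  have hC0 : 0 ≤ C := (norm_nonneg _).trans (hC 0)
  refine le_of_sq_le_sq ?_ (by positivity)
  rw [mul_pow, lp.norm_sq_eq_tsum h, ← tsum_mul_left, lp.norm_sq_eq_tsum]
  exact Summable.tsum_le_tsum (norm_sq_apply_le A hC h)
    (lp.summable_norm_sq (lpDiagonalₗ A hC h)) ((lp.summable_norm_sq h).mul_left _)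

/-- The diagonal operator on an `ℓ²` direct sum with uniformly bounded entries. -/
def lpDiagonal (A : ∀ n, G n →L[ℂ] G n) {C : ℝ} (hC : ∀ n, ‖A n‖ ≤ C) : lp G 2 →L[ℂ] lp G 2 :=
  (lpDiagonalₗ A hC).mkContinuous C (norm_lpDiagonalₗ_apply_le A hC)

variable {A : ∀ n, G n →L[ℂ] G n} {C : ℝ} {hC : ∀ n, ‖A n‖ ≤ C}

@[simp]
theorem lpDiagonal_apply (h : lp G 2) (n : ℕ) : lpDiagonal A hC h n = A n (h n) := rfl

theorem norm_lpDiagonal_le : ‖lpDiagonal A hC‖ ≤ C :=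
  LinearMap.mkContinuous_norm_le _ ((norm_nonneg _).trans (hC 0)) (norm_lpDiagonalₗ_apply_le A hC)

theorem lpDiagonal_single (n : ℕ) (x : G n) :
    lpDiagonal A hC (lp.single 2 n x) = lp.single 2 n (A n x) := by
  ext m
  rw [lpDiagonal_apply]
  rcases eq_or_ne m n with rfl | hmn
  · simp
  · simp [hmn]

theorem IsContractionGroup.lpDiagonal {u : ∀ n, ℝ → G n →L[ℂ] G n}
    (hu : ∀ n, IsContractionGroup (u n)) :
    IsContractionGroup fun t => lpDiagonal (fun n => u n t) fun n => (hu n).norm_le t where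
  zero h := by ext n; exact (hu n).zero _
  add s t h := by ext n; exact (hu n).add _ _ _
  norm_le t := norm_lpDiagonal_le
  continuous h := by
    rw [continuous_iff_continuousAt]
    intro t₀
    rw [ContinuousAt, tendsto_iff_norm_sub_tendsto_zero]
    suffices H : Tendsto (fun t => ∑' n, ‖u n t (h n) - u n t₀ (h n)‖ ^ 2) (𝓝 t₀)
        (𝓝 (∑' n : ℕ, (0 : ℝ))) by
      have H' := H.sqrt
      simp only [tsum_zero, Real.sqrt_zero] at H'
      refine H'.congr fun t => ?_
      rw [← Real.sqrt_sq (norm_nonneg (_ - _)), lp.norm_sq_eq_tsum]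
      rfl
    -- The components need not be equicontinuous in `t`; contractivity supplies the summable
    -- majorant `(2 ‖h n‖)²`.
    refine tendsto_tsum_of_dominated_convergence
      (bound := fun n => 4 * ‖h n‖ ^ 2) ((lp.summable_norm_sq h).mul_left 4) (fun n => ?_)
      (Eventually.of_forall fun t n => ?_)
    · have h1 : Continuous fun t => ‖u n t (h n) - u n t₀ (h n)‖ ^ 2 :=
        (((hu n).continuous (h n)).sub continuous_const).norm.pow 2
      simpa using h1.tendsto t₀
    · rw [Real.norm_of_nonneg (by positivity)]
      have h1 : ‖u n t (h n) - u n t₀ (h n)‖ ≤ 2 * ‖h n‖ :=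
        (norm_sub_le _ _).trans (by
          linarith [(hu n).norm_apply_le t (h n), (hu n).norm_apply_le t₀ (h n)])
      calc _ ≤ (2 * ‖h n‖) ^ 2 := by gcongr
        _ = _ := by ring

/-- The unitary group of phases `exp (i e t)`. -/
def phaseGroup (X : Type*) [NormedAddCommGroup X] [NormedSpace ℂ X] (e t : ℝ) : X →L[ℂ] X :=
  Complex.exp (Complex.I * ((e * t : ℝ) : ℂ)) • ContinuousLinearMap.id ℂ X

theorem phaseGroup_apply {X : Type*} [NormedAddCommGroup X] [NormedSpace ℂ X] (e t : ℝ) (x : X) :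
    phaseGroup X e t x = Complex.exp (Complex.I * ((e * t : ℝ) : ℂ)) • x := rfl

theorem isContractionGroup_phaseGroup (X : Type*) [NormedAddCommGroup X] [NormedSpace ℂ X]
    (e : ℝ) : IsContractionGroup (phaseGroup X e) where
  zero x := by simp [phaseGroup_apply]
  add s t x := by
    simp only [phaseGroup_apply, smul_smul, ← Complex.exp_add]
    congr 2
    push_cast
    ring
  norm_le t := by
    refine ContinuousLinearMap.opNorm_le_bound _ zero_le_one fun x => ?_
    rw [phaseGroup_apply, norm_smul, mul_comm Complex.I, Complex.norm_exp_ofReal_mul_I]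
  continuous x := by
    simp only [phaseGroup_apply]
    exact Continuous.smul (by fun_prop) continuous_const

/-- The diagonal operator of phases `exp (i E_n t)`. -/
def phaseDiagonal (G : ℕ → Type*) [∀ n, NormedAddCommGroup (G n)] [∀ n, NormedSpace ℂ (G n)]
    (E : ℕ → ℝ) (t : ℝ) : lp G 2 →L[ℂ] lp G 2 :=
  lpDiagonal (fun n => phaseGroup (G n) (E n) t)
    fun n => (isContractionGroup_phaseGroup (G n) (E n)).norm_le t

theorem isContractionGroup_phaseDiagonal (E : ℕ → ℝ) : IsContractionGroup (phaseDiagonal G E) :=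
  IsContractionGroup.lpDiagonal fun n => isContractionGroup_phaseGroup (G n) (E n)

theorem phaseDiagonal_apply (E : ℕ → ℝ) (t : ℝ) (h : lp G 2) (n : ℕ) :
    phaseDiagonal G E t h n = Complex.exp (Complex.I * ((E n * t : ℝ) : ℂ)) • h n := rfl

theorem phaseDiagonal_single (E : ℕ → ℝ) (t : ℝ) (n : ℕ) (x : G n) :
    phaseDiagonal G E t (lp.single 2 n x)
      = Complex.exp (Complex.I * ((E n * t : ℝ) : ℂ)) • lp.single 2 n x := by
  rw [phaseDiagonal, lpDiagonal_single, phaseGroup_apply, lp.single_smul]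

/-- The operator `T` conjugated by rapidly oscillating phases. -/
def oscillatingOperator (E : ℕ → ℝ) (T : lp G 2 →L[ℂ] lp G 2) (ε t : ℝ) : lp G 2 →L[ℂ] lp G 2 :=
  (phaseDiagonal G E (t / ε ^ 2)).comp (T.comp (phaseDiagonal G E (-(t / ε ^ 2))))

theorem norm_oscillatingOperator_le (E : ℕ → ℝ) (T : lp G 2 →L[ℂ] lp G 2) (ε t : ℝ) :
    ‖oscillatingOperator E T ε t‖ ≤ ‖T‖ := by
  have hD := isContractionGroup_phaseDiagonal (G := G) E
  refine ContinuousLinearMap.opNorm_le_bound _ (norm_nonneg _) fun x => ?_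
  exact (hD.norm_apply_le _ _).trans ((T.le_opNorm _).trans
    (by gcongr; exact hD.norm_apply_le _ _))

theorem continuous_oscillatingOperator (E : ℕ → ℝ) (T : lp G 2 →L[ℂ] lp G 2) (ε : ℝ)
    (x : lp G 2) : Continuous fun t => oscillatingOperator E T ε t x := by
  have hD := isContractionGroup_phaseDiagonal (G := G) E
  have hc : Continuous fun t : ℝ => t / ε ^ 2 := by fun_prop
  exact hD.continuous_apply hc (T.continuous.comp (hD.continuous_apply hc.neg continuous_const))

/-- Only the diagonal part of `T` survives the averaging over rapidly oscillating phases. -/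
theorem tendsto_integral_oscillatingOperator_sub {U : ℝ → lp G 2 →L[ℂ] lp G 2}
    (hU : IsContractionGroup U) {E : ℕ → ℝ} (hE : Function.Injective E)
    (T Td : lp G 2 →L[ℂ] lp G 2)
    (hTd : ∀ n x, Td (lp.single 2 n x) = lp.single 2 n (T (lp.single 2 n x) n))
    {q : ℝ → lp G 2} (hq : Continuous q) {t : ℝ} (ht : 0 ≤ t) :
    Tendsto (fun ε => ∫ s in (0 : ℝ)..t, U (-s) ((oscillatingOperator E T ε s - Td) (q s)))
      (𝓝[>] 0) (𝓝 0) := by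
  have hD := isContractionGroup_phaseDiagonal (G := G) E
  -- First reduction: the input is concentrated in one band `m`.
  refine tendsto_integral_of_tendsto_integral_single (C := ‖T‖ + ‖Td‖)
    (S := fun ε s => (U (-s)).comp (oscillatingOperator E T ε s - Td)) (fun ε s => ?_)
    (fun ε x => ?_) ht (fun m p hp => ?_) hq
  · refine ContinuousLinearMap.opNorm_le_bound _ (by positivity) fun x => ?_
    exact (hU.norm_apply_le _ _).trans (ContinuousLinearMap.le_of_opNorm_le _
      ((norm_sub_le _ _).trans (by gcongr; exact norm_oscillatingOperator_le E T ε s)) _)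
  · exact hU.continuous_apply continuous_neg
      ((continuous_oscillatingOperator E T ε x).sub continuous_const)
  -- On band `m` the right phase operator is the scalar `exp(-i E_m s/ε²)` and `Td` keeps only the
  -- `m`-th component of `T`. Hence the integrand is `Z ε s` applied to the curve `T (lp.single 2 m
  -- (p s))`, which is free of `ε`.
  let Z : ℝ → ℝ → lp G 2 →L[ℂ] lp G 2 := fun ε s => (U (-s)).comp
    (Complex.exp (Complex.I * ((E m * -(s / ε ^ 2) : ℝ) : ℂ)) • phaseDiagonal G E (s / ε ^ 2)
      - (lp.singleContinuousLinearMap ℂ G 2 m).comp (lp.evalCLM ℂ G 2 m))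
  have hZ : ∀ ε s x, Z ε s x = U (-s) (Complex.exp (Complex.I * ((E m * -(s / ε ^ 2) : ℝ) : ℂ)) •
      phaseDiagonal G E (s / ε ^ 2) x - lp.single 2 m (x m)) := fun ε s x => rfl
  have hk : Continuous fun s => T (lp.single 2 m (p s)) :=
    T.continuous.comp ((lp.isometry_single (E := G) (p := 2) m).continuous.comp hp)
  have hmain : Tendsto (fun ε => ∫ s in (0 : ℝ)..t, Z ε s (T (lp.single 2 m (p s))))
      (𝓝[>] 0) (𝓝 0) := by
    -- Second reduction, over output bands `n`: for `n = m` the phases cancel and the subtracted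
    -- term removes the rest; for `n ≠ m` a nonzero frequency remains.
    refine tendsto_integral_of_tendsto_integral_single (C := 2) (fun ε s => ?_)
      (fun ε x => ?_) ht (fun n p' hp' => ?_) hk
    · refine ContinuousLinearMap.opNorm_le_bound _ (by positivity) fun x => ?_
      rw [hZ]
      refine (hU.norm_apply_le _ _).trans ((norm_sub_le _ _).trans ?_)
      rw [norm_smul, mul_comm Complex.I, Complex.norm_exp_ofReal_mul_I,
        lp.norm_single (by norm_num)]
      linarith [hD.norm_apply_le (s / ε ^ 2) x, lp.norm_apply_le_norm (p := 2) (by norm_num) x m]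
    · have hc : Continuous fun s : ℝ => s / ε ^ 2 := by fun_prop
      refine hU.continuous_apply continuous_neg (Continuous.sub (Continuous.smul (by fun_prop)
        (hD.continuous_apply hc continuous_const)) continuous_const)
    · have hone : ∀ ε s, Z ε s (lp.single 2 n (p' s)) =
          if n = m then 0 else Complex.exp (Complex.I * (((E n - E m) * (s / ε ^ 2) : ℝ) : ℂ)) •
            U (-s) (lp.single 2 n (p' s)) := fun ε s => by
        rw [hZ, phaseDiagonal_single, smul_smul, ← Complex.exp_add]
        split_ifs with hnm
        · subst hnm
          rw [lp.single_apply_self, ← mul_add, ← Complex.ofReal_add]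
          simp
        · rw [lp.single_apply_ne _ _ _ (Ne.symm hnm), lp.single_zero, sub_zero, map_smul]
          congr 2
          push_cast
          ring
      simp only [hone]
      split_ifs with hnm
      · simp
      · exact tendsto_integral_exp_smul_nhdsGT _ (sub_ne_zero.2 fun h => hnm (hE h)) ht
  refine hmain.congr fun ε => ?_
  refine intervalIntegral.integral_congr fun s _ => ?_
  simp only [ContinuousLinearMap.comp_apply, sub_apply, hZ, hTd,
    oscillatingOperator, phaseDiagonal_single, map_smul]

end Diagonal

/-! ### Multiplication operators on `L²` -/

section Multiplication

/-- The phase `exp (-i t Q(x) / 2)`. -/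
def quadraticPhase {α : Type*} (Q : α → ℝ) (t : ℝ) (x : α) : ℂ :=
  Complex.exp (-(Complex.I * (t / 2 : ℝ) * (Q x : ℝ)))

theorem norm_quadraticPhase {α : Type*} (Q : α → ℝ) (t : ℝ) (x : α) : ‖quadraticPhase Q t x‖ = 1 := by
  have : -(Complex.I * (t / 2 : ℝ) * (Q x : ℝ)) = ((-(t / 2 * Q x) : ℝ) : ℂ) * Complex.I := by
    push_cast; ring
  rw [quadraticPhase, this, Complex.norm_exp_ofReal_mul_I]

variable {α : Type*} [MeasurableSpace α] {ν : Measure α}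

/-- Multiplication by an essentially bounded function, as an operator on `L²`. -/
def mulOperator {a : α → ℂ} (ha : MemLp a ⊤ ν) : Lp ℂ 2 ν →L[ℂ] Lp ℂ 2 ν :=
  (ContinuousLinearMap.mul ℂ ℂ).holderL ν ⊤ 2 2 (ha.toLp a)

theorem coeFn_mulOperator {a : α → ℂ} (ha : MemLp a ⊤ ν) (f : Lp ℂ 2 ν) :
    mulOperator ha f =ᵐ[ν] fun x => a x * f x := by
  have h := (ContinuousLinearMap.mul ℂ ℂ).coeFn_holder (r := 2) (ha.toLp a) f
  filter_upwards [h, ha.coeFn_toLp] with x hx hx'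
  refine Eq.trans hx ?_
  simp [hx']

theorem norm_sq_eq_integral_norm_sq (f : Lp ℂ 2 ν) : ‖f‖ ^ 2 = ∫ x, ‖f x‖ ^ 2 ∂ν := by
  have h := L2.inner_def (𝕜 := ℂ) f f
  simp only [inner_self_eq_norm_sq_to_K] at h
  have h2 : (∫ x, ((‖f x‖ : ℂ)) ^ 2 ∂ν) = ((∫ x, ‖f x‖ ^ 2 ∂ν : ℝ) : ℂ) := by
    rw [← integral_complex_ofReal]
    simp
  refine Complex.ofReal_injective ?_
  rw [← h2, Complex.ofReal_pow]
  exact h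

theorem memLp_quadraticPhase {Q : α → ℝ} (hQ : Measurable Q) (t : ℝ) :
    MemLp (quadraticPhase Q t) ⊤ ν := by
  refine memLp_top_of_bound (Measurable.aestronglyMeasurable ?_) 1
    (ae_of_all _ fun x => (norm_quadraticPhase Q t x).le)
  unfold quadraticPhase
  fun_prop

theorem isContractionGroup_quadraticPhase {Q : α → ℝ} (hQ : Measurable Q) :
    IsContractionGroup fun t => mulOperator (ν := ν) (memLp_quadraticPhase hQ t) where
  zero f := by
    refine Lp.ext ?_
    filter_upwards [coeFn_mulOperator (memLp_quadraticPhase hQ 0) f] with x hx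
    rw [hx]
    simp [quadraticPhase]
  add s t f := by
    refine Lp.ext ?_
    filter_upwards [coeFn_mulOperator (memLp_quadraticPhase hQ (s + t)) f,
      coeFn_mulOperator (memLp_quadraticPhase hQ t) f,
      coeFn_mulOperator (memLp_quadraticPhase hQ s)
        (mulOperator (memLp_quadraticPhase hQ t) f)] with x h1 h2 h3
    rw [h1, h3, h2, ← mul_assoc, quadraticPhase, quadraticPhase, quadraticPhase,
      ← Complex.exp_add]
    congr 2
    push_cast
    ring
  norm_le t := by
    refine ContinuousLinearMap.opNorm_le_bound _ zero_le_one fun f => ?_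
    refine Lp.norm_le_mul_norm_of_ae_le_mul ?_
    filter_upwards [coeFn_mulOperator (memLp_quadraticPhase hQ t) f] with x hx
    rw [hx, norm_mul, norm_quadraticPhase]
  continuous f := by
    rw [continuous_iff_continuousAt]
    intro t₀
    rw [ContinuousAt, tendsto_iff_norm_sub_tendsto_zero]
    suffices H : Tendsto
        (fun t => ∫ x, ‖(quadraticPhase Q t x - quadraticPhase Q t₀ x) * f x‖ ^ 2 ∂ν) (𝓝 t₀)
        (𝓝 (∫ _, (0 : ℝ) ∂ν)) by
      have H' := H.sqrt
      simp only [integral_zero, Real.sqrt_zero] at H'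
      refine H'.congr fun t => ?_
      rw [← Real.sqrt_sq (norm_nonneg (_ - _)), norm_sq_eq_integral_norm_sq]
      congr 1
      refine integral_congr_ae ?_
      filter_upwards [coeFn_mulOperator (memLp_quadraticPhase hQ t) f,
        coeFn_mulOperator (memLp_quadraticPhase hQ t₀) f,
        Lp.coeFn_sub (mulOperator (memLp_quadraticPhase hQ t) f)
          (mulOperator (memLp_quadraticPhase hQ t₀) f)] with x h1 h2 h3
      rw [h3, Pi.sub_apply, h1, h2, sub_mul]
    -- `Q` may be unbounded, so continuity is obtained for each fixed `f` only, from pointwise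
    -- convergence of the phases.
    refine tendsto_integral_filter_of_dominated_convergence (fun x => 4 * ‖f x‖ ^ 2)
      (Eventually.of_forall fun t => ?_) (Eventually.of_forall fun t => ae_of_all _ fun x => ?_)
      ?_ (ae_of_all _ fun x => ?_)
    · exact ((((memLp_quadraticPhase hQ t).1.sub (memLp_quadraticPhase hQ t₀).1).mul
        (Lp.aestronglyMeasurable f)).norm.pow 2)
    · rw [Real.norm_of_nonneg (by positivity), norm_mul]
      have h1 : ‖quadraticPhase Q t x - quadraticPhase Q t₀ x‖ ≤ 2 :=
        (norm_sub_le _ _).trans (by rw [norm_quadraticPhase, norm_quadraticPhase]; norm_num)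
      calc _ ≤ (2 * ‖f x‖) ^ 2 := by gcongr
        _ = _ := by ring
    · exact ((memLp_two_iff_integrable_sq_norm (Lp.aestronglyMeasurable f)).1
        (Lp.memLp f)).const_mul 4
    · have hc : Continuous fun t => ‖(quadraticPhase Q t x - quadraticPhase Q t₀ x) * f x‖ ^ 2 := by
        unfold quadraticPhase
        fun_prop
      simpa using hc.tendsto t₀

theorem mulL2_eq_mulOperator {d : ℕ} {a : Pos d → ℂ} (ha : MemLp a ⊤ volume) (f : L2Space d) :
    mulL2 a f = mulOperator ha f := by
  have hmem : MemLp (fun x => a x * f x) 2 volume :=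
    (memLp_congr_ae (coeFn_mulOperator ha f)).1 (Lp.memLp _)
  rw [mulL2, dif_pos hmem]
  exact Lp.ext (hmem.coeFn_toLp.trans (coeFn_mulOperator ha f).symm)

/-- The quadratic form `k · M k` with `k = 2π ξ`. -/
def massForm {d : ℕ} (M : Matrix (Fin d) (Fin d) ℝ) (ξ : Pos d) : ℝ :=
  ((2 * Real.pi) • ξ).ofLp ⬝ᵥ M.mulVec ((2 * Real.pi) • ξ).ofLp

theorem measurable_massForm {d : ℕ} (M : Matrix (Fin d) (Fin d) ℝ) : Measurable (massForm M) := by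
  refine Continuous.measurable ?_
  unfold massForm dotProduct Matrix.mulVec dotProduct
  fun_prop

/-- The free unitary group as a family of bounded operators. -/
def freeOperator {d : ℕ} (M : Matrix (Fin d) (Fin d) ℝ) (t : ℝ) : L2Space d →L[ℂ] L2Space d :=
  ((Lp.fourierTransformₗᵢ (Pos d) ℂ).symm : L2Space d →L[ℂ] L2Space d).comp
    ((mulOperator (memLp_quadraticPhase (measurable_massForm M) t)).comp
      (Lp.fourierTransformₗᵢ (Pos d) ℂ : L2Space d →L[ℂ] L2Space d))

theorem freeOperator_apply {d : ℕ} (M : Matrix (Fin d) (Fin d) ℝ) (t : ℝ) (f : L2Space d) :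
    freeOperator M t f = freeGroup M t f := by
  rw [freeGroup]
  exact congrArg _ (mulL2_eq_mulOperator (memLp_quadraticPhase (measurable_massForm M) t) _).symm

theorem freeOperator_apply' {d : ℕ} (M : Matrix (Fin d) (Fin d) ℝ) (t : ℝ) (f : L2Space d) :
    freeOperator M t f = (Lp.fourierTransformₗᵢ (Pos d) ℂ).symm
      (mulOperator (memLp_quadraticPhase (measurable_massForm M) t)
        (Lp.fourierTransformₗᵢ (Pos d) ℂ f)) := rfl

theorem isContractionGroup_freeOperator {d : ℕ} (M : Matrix (Fin d) (Fin d) ℝ) :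
    IsContractionGroup (freeOperator M) := by
  have hQ := isContractionGroup_quadraticPhase (ν := (volume : Measure (Pos d)))
    (measurable_massForm M)
  refine ⟨fun f => ?_, fun s t f => ?_, fun t => ?_, fun f => ?_⟩
  · rw [freeOperator_apply', hQ.zero, LinearIsometryEquiv.symm_apply_apply]
  · simp only [freeOperator_apply', LinearIsometryEquiv.apply_symm_apply, hQ.add]
  · refine ContinuousLinearMap.opNorm_le_bound _ zero_le_one fun f => ?_
    rw [freeOperator_apply', LinearIsometryEquiv.norm_map, one_mul]
    exact (hQ.norm_apply_le _ _).trans_eq (LinearIsometryEquiv.norm_map _ _)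
  · exact (Lp.fourierTransformₗᵢ (Pos d) ℂ).symm.continuous.comp (hQ.continuous _)

end Multiplication

/-! ### Tensor products with an orthonormal family -/

section Tensor

variable {α β : Type*} [MeasurableSpace α] [MeasurableSpace β] {μ : Measure α} {ν : Measure β}

theorem memLp_two_tensor {f : α → ℂ} {w : β → ℂ} (hf : MemLp f 2 μ) (hw : MemLp w 2 ν) :
    MemLp (fun p : α × β => f p.1 * w p.2) 2 (μ.prod ν) := by
  refine (memLp_two_iff_integrable_sq_norm (hf.1.comp_fst.mul hw.1.comp_snd)).2 ?_
  simp only [Pi.mul_apply, norm_mul, mul_pow]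
  exact ((memLp_two_iff_integrable_sq_norm hf.1).1 hf).mul_prod
    ((memLp_two_iff_integrable_sq_norm hw.1).1 hw)

theorem aestronglyMeasurable_matrixElement {w w' : β → ℂ} (hw : MemLp w 2 ν) (hw' : MemLp w' 2 ν)
    {a : α × β → ℂ} (ha : MemLp a ⊤ (μ.prod ν)) :
    AEStronglyMeasurable (fun p : α × β => conj (w p.2) * w' p.2 * a p) (μ.prod ν) :=
  ((Complex.continuous_conj.comp_aestronglyMeasurable hw.1.comp_snd).mul hw'.1.comp_snd).mul ha.1

/-- For almost every `x` the bound `‖a‖ ≤ K` holds for almost every `z`, and `‖w‖ ‖w'‖` is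
integrable. -/
theorem memLp_top_matrixElement [SFinite ν] {w w' : β → ℂ} (hw : MemLp w 2 ν) (hw' : MemLp w' 2 ν)
    {a : α × β → ℂ} (ha : MemLp a ⊤ (μ.prod ν)) :
    MemLp (fun x => ∫ z, conj (w z) * w' z * a (x, z) ∂ν) ⊤ μ := by
  obtain ⟨K, hK⟩ : ∃ K : ℝ, ∀ᵐ p ∂(μ.prod ν), ‖a p‖ ≤ K :=
    ⟨_, ae_le_lpNorm_exponent_top ha⟩
  refine memLp_top_of_bound (aestronglyMeasurable_matrixElement hw hw' ha).integral_prod_right'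
    (∫ z, ‖w z‖ * ‖w' z‖ * K ∂ν) ?_
  filter_upwards [Measure.ae_ae_of_ae_prod hK] with x hx
  refine norm_integral_le_of_norm_le ((hw.norm.integrable_mul hw'.norm).mul_const K) ?_
  filter_upwards [hx] with z hz
  rw [norm_mul, norm_mul, RCLike.norm_conj]
  gcongr

variable [SFinite μ] [SFinite ν]

/-- The map `f ↦ f ⊗ w`. -/
def tensorRight (μ : Measure α) [SFinite μ] {w : β → ℂ} (hw : MemLp w 2 ν) :
    Lp ℂ 2 μ →ₗ[ℂ] Lp ℂ 2 (μ.prod ν) where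
  toFun f := (memLp_two_tensor (Lp.memLp f) hw).toLp _
  map_add' f g := by
    rw [← MemLp.toLp_add]
    refine MemLp.toLp_congr _ _ ?_
    filter_upwards [Measure.quasiMeasurePreserving_fst.ae (Lp.coeFn_add f g)] with p hp
    rw [hp]
    simp [add_mul]
  map_smul' c f := by
    rw [RingHom.id_apply, ← MemLp.toLp_const_smul]
    refine MemLp.toLp_congr _ _ ?_
    filter_upwards [Measure.quasiMeasurePreserving_fst.ae (Lp.coeFn_smul c f)] with p hp
    rw [hp]
    simp [mul_assoc]

theorem coeFn_tensorRight {w : β → ℂ} (hw : MemLp w 2 ν) (f : Lp ℂ 2 μ) :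
    tensorRight μ hw f =ᵐ[μ.prod ν] fun p => f p.1 * w p.2 :=
  MemLp.coeFn_toLp (memLp_two_tensor (Lp.memLp f) hw)

/-- Integrals of product functions factorize; this turns orthonormality of the `v n` into isometries
with mutually orthogonal ranges. -/
theorem inner_tensorRight {w w' : β → ℂ} (hw : MemLp w 2 ν) (hw' : MemLp w' 2 ν)
    (f g : Lp ℂ 2 μ) :
    inner ℂ (tensorRight μ hw f) (tensorRight μ hw' g)
      = inner ℂ f g * ∫ z, conj (w z) * w' z ∂ν := by
  rw [L2.inner_def, L2.inner_def, ← integral_prod_mul]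
  refine integral_congr_ae ?_
  filter_upwards [coeFn_tensorRight hw f, coeFn_tensorRight hw' g] with p h1 h2
  rw [h1, h2]
  simp only [RCLike.inner_apply, map_mul]
  ring

variable {v : ℕ → β → ℂ} (hv : ∀ n, MemLp (v n) 2 ν)
  (horth : ∀ n m, ∫ z, conj (v n z) * v m z ∂ν = if n = m then 1 else 0)

/-- The isometry `f ↦ f ⊗ v_n` for a normalized function `v_n`. -/
def tensorIsometry (μ : Measure α) [SFinite μ] (hv : ∀ n, MemLp (v n) 2 ν)
    (horth : ∀ n m, ∫ z, conj (v n z) * v m z ∂ν = if n = m then 1 else 0) (n : ℕ) :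
    Lp ℂ 2 μ →ₗᵢ[ℂ] Lp ℂ 2 (μ.prod ν) :=
  (tensorRight μ (hv n)).isometryOfInner fun f g => by
    rw [inner_tensorRight, horth n n, if_pos rfl, mul_one]

theorem orthogonalFamily_tensorIsometry :
    OrthogonalFamily ℂ (fun _ : ℕ => Lp ℂ 2 μ) (tensorIsometry μ hv horth) := by
  intro n m hnm f g
  exact (inner_tensorRight (hv n) (hv m) f g).trans (by rw [horth n m, if_neg hnm, mul_zero])

/-- The matrix operator with entries `∫ conj(v_n) v_m a(x, ·)`: the compression of multiplication
by `a` to the range of `(f_n) ↦ ∑ f_n ⊗ v_n`. -/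
def compressedMultiplication (hv : ∀ n, MemLp (v n) 2 ν)
    (horth : ∀ n m, ∫ z, conj (v n z) * v m z ∂ν = if n = m then 1 else 0)
    {a : α × β → ℂ} (ha : MemLp a ⊤ (μ.prod ν)) :
    lp (fun _ : ℕ => Lp ℂ 2 μ) 2 →L[ℂ] lp (fun _ : ℕ => Lp ℂ 2 μ) 2 :=
  let J := (orthogonalFamily_tensorIsometry (μ := μ) hv horth).linearIsometry.toContinuousLinearMap
  (ContinuousLinearMap.adjoint J).comp ((mulOperator ha).comp J)

/-- Tested against `f`, the left side is `⟨f ⊗ v_n, a (g ⊗ v_m)⟩`; by Fubini the `z`-integral can be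
done first, which produces the matrix element. -/
theorem compressedMultiplication_single {a : α × β → ℂ} (ha : MemLp a ⊤ (μ.prod ν)) (n m : ℕ)
    (g : Lp ℂ 2 μ) :
    compressedMultiplication hv horth ha (lp.single 2 m g) n
      = mulOperator (memLp_top_matrixElement (hv n) (hv m) ha) g := by
  refine ext_inner_left ℂ fun f => ?_
  have hJ := fun k (f : Lp ℂ 2 μ) =>
    (orthogonalFamily_tensorIsometry (μ := μ) hv horth).linearIsometry_apply_single (i := k) f
  refine (lp.inner_single_left (𝕜 := ℂ) (G := fun _ : ℕ => Lp ℂ 2 μ) n f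
    (compressedMultiplication hv horth ha (lp.single 2 m g))).symm.trans ?_
  rw [compressedMultiplication]
  simp only [ContinuousLinearMap.comp_apply, ContinuousLinearMap.adjoint_inner_right]
  change inner ℂ ((orthogonalFamily_tensorIsometry hv horth).linearIsometry (lp.single 2 n f))
    (mulOperator ha
      ((orthogonalFamily_tensorIsometry hv horth).linearIsometry (lp.single 2 m g))) = _
  rw [hJ, hJ]
  change inner ℂ (tensorRight μ (hv n) f) (mulOperator ha (tensorRight μ (hv m) g)) = _
  have hae : (fun p => inner ℂ (tensorRight μ (hv n) f p)
      (mulOperator ha (tensorRight μ (hv m) g) p)) =ᵐ[μ.prod ν]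
      fun p => (g p.1 * conj (f p.1)) * (conj (v n p.2) * v m p.2 * a p) := by
    filter_upwards [coeFn_tensorRight (hv n) f, coeFn_tensorRight (hv m) g,
      coeFn_mulOperator ha (tensorRight μ (hv m) g)] with p h1 h2 h3
    rw [h1, h3, h2]
    simp only [RCLike.inner_apply, map_mul]
    ring
  rw [L2.inner_def, L2.inner_def, integral_congr_ae hae,
    integral_prod _ ((L2.integrable_inner (𝕜 := ℂ) _ _).congr hae)]
  refine integral_congr_ae ?_
  filter_upwards [coeFn_mulOperator (memLp_top_matrixElement (hv n) (hv m) ha) g] with x hx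
  rw [hx, integral_const_mul]
  simp only [RCLike.inner_apply]
  ring

end Tensor

/-! ### The envelope function systems -/

/-- Taking a component is a bounded linear map, so it commutes with the `ℓ²`-valued Duhamel
integral, whose integrand is continuous on `[0, t]`. -/
theorem isMildSolution_iff_isMild {d : ℕ} {M : ℕ → Matrix (Fin d) (Fin d) ℝ}
    {B : ℝ → EnvSpace d → ℕ → L2Space d} {T : ℝ → EnvSpace d →L[ℂ] EnvSpace d} {C : ℝ}
    (hC : ∀ t, ‖T t‖ ≤ C) (hT : ∀ x, Continuous fun t => T t x)
    (hBT : ∀ t h n, B t h n = T t h n) (f : EnvSpace d) (h : ℝ → EnvSpace d) :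
    IsMildSolution M B f h ↔ IsMild (fun t => lpDiagonal (fun n => freeOperator (M n) t)
      fun n => (isContractionGroup_freeOperator (M n)).norm_le t) T f h := by
  have hU := IsContractionGroup.lpDiagonal fun n => isContractionGroup_freeOperator (M n)
  refine and_congr_right fun hh => forall₂_congr fun t ht => ?_
  have hint : IntervalIntegrable (fun s => lpDiagonal (fun n => freeOperator (M n) (t - s))
      (fun n => (isContractionGroup_freeOperator (M n)).norm_le (t - s)) (T s (h s)))
      volume 0 t := by
    refine ContinuousOn.intervalIntegrable ?_
    rw [uIcc_of_le ht, continuousOn_iff_continuous_domRestrict]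
    refine hU.continuous_apply (a := fun s : Icc 0 t => t - (s : ℝ)) (by fun_prop)
      (continuous_apply_of_strongly_continuous (A := fun s : Icc 0 t => T s) (fun s => hC s)
        (fun x => (hT x).comp continuous_subtype_val) (y := fun s : Icc 0 t => h s) ?_)
    exact hh.comp_continuous continuous_subtype_val fun s => mem_Ici.2 s.2.1
  have hcomp : ∀ n, (∫ s in (0 : ℝ)..t, lpDiagonal (fun n => freeOperator (M n) (t - s))
      (fun n => (isContractionGroup_freeOperator (M n)).norm_le (t - s)) (T s (h s))) n
      = ∫ s in (0 : ℝ)..t, freeGroup (M n) (t - s) (B s (h s) n) := fun n => by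
    refine ((lp.evalCLM ℂ (fun _ : ℕ => L2Space d) 2 n).intervalIntegral_comp_comm hint).symm.trans
      (intervalIntegral.integral_congr fun s _ => ?_)
    simp only [hBT, ← freeOperator_apply]
    rfl
  rw [lp.ext_iff, funext_iff]
  refine forall_congr' fun n => ?_
  rw [← hcomp, ← freeOperator_apply]
  rfl

/-- A vector of `ℓ²` is the sum of its single-band parts, and bounded operators act termwise. So the
row series really converges and its `tsum` is not a default value. -/
theorem oscillatingCoupling_eq {d : ℕ} (E : ℕ → ℝ) {u : ℕ → ℕ → Pos d → ℂ}
    {T : EnvSpace d →L[ℂ] EnvSpace d} (hT : ∀ n m x, T (lp.single 2 m x) n = mulL2 (u n m) x)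
    (ε t : ℝ) (h : EnvSpace d) (n : ℕ) :
    oscillatingCoupling E u ε t h n = oscillatingOperator E T ε t h n := by
  have h1 := lp.hasSum_single (p := 2) (by norm_num)
    (phaseDiagonal (fun _ : ℕ => L2Space d) E (-(t / ε ^ 2)) h)
  have h2 := h1.mapL ((lp.evalCLM ℂ (fun _ : ℕ => L2Space d) 2 n).comp
    ((phaseDiagonal (fun _ : ℕ => L2Space d) E (t / ε ^ 2)).comp T))
  rw [oscillatingCoupling]
  refine (tsum_congr fun m => ?_).trans h2.tsum_eq
  change _ = phaseDiagonal (fun _ : ℕ => L2Space d) E (t / ε ^ 2) (T (lp.single 2 m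
    (phaseDiagonal (fun _ : ℕ => L2Space d) E (-(t / ε ^ 2)) h m))) n
  rw [phaseDiagonal_apply, phaseDiagonal_apply, lp.single_smul, map_smul, lp.coeFn_smul,
    Pi.smul_apply, hT, smul_smul, ← Complex.exp_add]
  congr 2
  push_cast
  ring

theorem hasUniqueMildSolution_of_bounded {d : ℕ} {M : ℕ → Matrix (Fin d) (Fin d) ℝ}
    {B : ℝ → EnvSpace d → ℕ → L2Space d} {T : ℝ → EnvSpace d →L[ℂ] EnvSpace d} {C : ℝ}
    (hC : ∀ t, ‖T t‖ ≤ C) (hT : ∀ x, Continuous fun t => T t x)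
    (hBT : ∀ t h n, B t h n = T t h n) (f : EnvSpace d) : HasUniqueMildSolution M B f := by
  have hU := IsContractionGroup.lpDiagonal fun n => isContractionGroup_freeOperator (M n)
  have hiff := isMildSolution_iff_isMild (M := M) hC hT hBT f
  obtain ⟨h, hh⟩ := exists_isMild hU hC hT f
  exact ⟨h, (hiff h).2 hh, fun h' hh' => hh.eqOn hU hC hT ((hiff h').1 hh')⟩

end

/-- The convergence uses only the boundedness of `V`, the orthonormality of the `v n` and the
simplicity of the spectrum: the off-diagonal couplings average out by the Riemann-Lebesgue lemma
along the limit trajectory. -/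
theorem theorem5p7 {d : ℕ} (L : Matrix (Fin d) (Fin d) ℝ) (hL : L.det ≠ 0)
    (W : Pos d → ℝ) (hW : MemLp W ⊤ volume) (hWper : LatticePeriodic L W)
    (E : ℕ → ℝ) (v : ℕ → Pos d → ℂ) (Dv : ℕ → Fin d → Pos d → ℂ)
    (hBloch : IsBlochSystem L W E v Dv)
    (μ : ℝ) (hμ : 0 < μ)
    (V : Pos d → Pos d → ℝ) (hV : MemPotentialClass L μ V)
    (fε : ℝ → EnvSpace d) (f : EnvSpace d)
    (hbdd : ∃ K : ℝ≥0, ∀ᶠ ε in 𝓝[>] (0 : ℝ), sobolevNormSq μ (fε ε) ≤ K)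
    (hlim : Tendsto (fun ε => ‖fε ε - f‖) (𝓝[>] (0 : ℝ)) (𝓝 0)) :
    (∀ ε : ℝ, 0 < ε → HasUniqueMildSolution (inverseMass L E v Dv)
      (oscillatingCoupling E (potentialMatrix L v V) ε) (fε ε)) ∧
    HasUniqueMildSolution (inverseMass L E v Dv)
      (diagonalCoupling (potentialMatrix L v V)) f ∧
    ∀ (hε : ℝ → ℝ → EnvSpace d) (h : ℝ → EnvSpace d),
      (∀ ε : ℝ, 0 < ε → IsMildSolution (inverseMass L E v Dv)
        (oscillatingCoupling E (potentialMatrix L v V) ε) (fε ε) (hε ε)) →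
      IsMildSolution (inverseMass L E v Dv)
        (diagonalCoupling (potentialMatrix L v V)) f h →
      ∀ τ : ℝ, TendstoUniformlyOn hε h (𝓝[>] (0 : ℝ)) (Icc 0 τ) := by
  have ha : MemLp (fun p : Pos d × Pos d => (V p.1 p.2 : ℂ)) ⊤
      ((volume : Measure (Pos d)).prod (volume.restrict (cell L))) := by
    have h1 := (hV.1.ofReal (K := ℂ)).restrict (univ ×ˢ cell L)
    rwa [Measure.volume_eq_prod, ← Measure.prod_restrict, Measure.restrict_univ] at h1
  let T : EnvSpace d →L[ℂ] EnvSpace d :=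
    compressedMultiplication (μ := volume) hBloch.memLp hBloch.orthonormal ha
  have hT : ∀ n m x, T (lp.single 2 m x) n = mulL2 (potentialMatrix L v V n m) x := fun n m x =>
    (compressedMultiplication_single hBloch.memLp hBloch.orthonormal ha n m x).trans
      (mulL2_eq_mulOperator
        (memLp_top_matrixElement (hBloch.memLp n) (hBloch.memLp m) ha) x).symm
  -- Cutting the diagonal entries out of `T` bounds them by `‖T‖` uniformly in `n`.
  let Tn : ∀ n, L2Space d →L[ℂ] L2Space d := fun n =>
    (lp.evalCLM ℂ (fun _ : ℕ => L2Space d) 2 n).comp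
      (T.comp (lp.singleContinuousLinearMap ℂ (fun _ : ℕ => L2Space d) 2 n))
  have hTn : ∀ n, ‖Tn n‖ ≤ ‖T‖ := fun n =>
    ContinuousLinearMap.opNorm_le_bound _ (norm_nonneg _) fun x =>
      (lp.norm_apply_le_norm (p := 2) (by norm_num) (T (lp.single 2 n x)) n).trans
        ((T.le_opNorm _).trans_eq (by rw [lp.norm_single (by norm_num)]))
  have hosc := fun ε t h n => oscillatingCoupling_eq E hT ε t h n
  have hdiag : ∀ t h n, diagonalCoupling (potentialMatrix L v V) t h n = lpDiagonal Tn hTn h n :=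
    fun t h n => (hT n n (h n)).symm
  have hoscN := fun ε => norm_oscillatingOperator_le E T ε
  have hoscC := fun ε => continuous_oscillatingOperator E T ε
  have hdiagN : ∀ _ : ℝ, ‖lpDiagonal Tn hTn‖ ≤ ‖T‖ := fun _ => norm_lpDiagonal_le
  have hdiagC : ∀ x, Continuous fun _ : ℝ => lpDiagonal Tn hTn x := fun _ => continuous_const
  refine ⟨fun ε _ => hasUniqueMildSolution_of_bounded (hoscN ε) (hoscC ε) (hosc ε) _,
    hasUniqueMildSolution_of_bounded hdiagN hdiagC hdiag _, fun hε h hhε hh τ => ?_⟩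
  have hU := IsContractionGroup.lpDiagonal
    fun n => isContractionGroup_freeOperator (inverseMass L E v Dv n)
  refine tendstoUniformlyOn_of_isMild hU hoscN hoscC hdiagN hdiagC (fun q hq t ht =>
    tendsto_integral_oscillatingOperator_sub hU hBloch.strictMono.injective T _
      (fun n x => lpDiagonal_single (A := Tn) (hC := hTn) n x) hq ht) hlim ?_
    ((isMildSolution_iff_isMild hdiagN hdiagC hdiag f h).1 hh) τ
  filter_upwards [self_mem_nhdsWithin] with ε hpos
  exact (isMildSolution_iff_isMild (hoscN ε) (hoscC ε) (hosc ε) _ _).1 (hhε ε hpos)
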